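/- Let $k\ge 2$ and let $\eta_2,\dots,\eta_k$ be fixed real numbers. For $\mu\in\mathbb R$, $\delta>0$, $\sigma>0$ let $Y(t)=\sigma B(t)$, $t\ge 0$, where $B$ is a standard Brownian motion in $\mathbb R^k$, started at $0$, with drift $(\mu,\dots,\mu,\mu+\delta)/\sigma$; system $k$ is the best system. For $I\subseteq\{1,\dots,k\}$ with $|I|\ge 2$ put $$\mathcal S_I(x)=\frac1{\sigma^2}\sum_{i\in I}(x_i-\bar x_I)^2,\qquad \bar x_I=\frac1{|I|}\sum_{i\in I}x_i,\qquad \delta_{|I|}^2=\delta^2\,\frac{|I|-1}{|I|}.$$ The continuous analogue of the procedure $\mathcal{DK}_1$ starts with the set $I=\{1,\dots,k\}$ of competing systems at time $0$. As long as $|I|\ge2$, it waits until the first time $t$, not earlier than the previous elimination, at which $\mathcal S_I(Y(t))\ge(\sigma\,\eta_{|I|}/\delta_{|I|})^2$; it then eliminates from $I$ the system with the smallest $Y_i(t)$, $i\in I$ (ties being broken in favour of eliminating the smallest index), and continues from time $t$ on with the reduced set. When one system is left, that system is selected; the selection is incorrect if it is not system $k$. The $\ell$-th elimination is called the elimination at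 level $\ell$ ($\ell=1,\dots,k-1$); it is made when $k-\ell+1$ systems compete. Then for every $\ell$ and every system $i$ the probability that system $i$ is eliminated at level $\ell$ (in particular, for $i=k$, the probability that the best system is incorrectly eliminated at level $\ell$), and the probability that some system is eliminated at level $\ell$, depend only on $k$, $\eta_2,\dots,\eta_k$, $\ell$ (and $i$), and not on $\delta$, $\sigma$ or $\mu$. In particular, the probability of incorrect selection does not depend on $\delta$ or $\sigma$ (nor on $\mu$). -/

import Mathlib

open MeasureTheory ProbabilityTheory
open scoped NNReal

namespace DK

/-- A standard Brownian motion in `ℝ^k` (started at `0`): the coordinates are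
independent standard one-dimensional Brownian motions. -/
structure IsStandardBrownian {Ω : Type*} [MeasurableSpace Ω] {k : ℕ}
    (B : ℝ≥0 → Ω → Fin k → ℝ) (P : Measure Ω) : Prop where
  brownian : ∀ i : Fin k, IsBrownianReal (fun t ω => B t ω i) P
  indep : iIndepFun (fun (i : Fin k) (ω : Ω) (t : ℝ≥0) => B t ω i) P

/-- The best system, the last one among the `k` systems. -/
def bestSystem (k : ℕ) (hk : 2 ≤ k) : Fin k := ⟨k - 1, by omega⟩

/-- The slippage configuration: the mean vector `(μ, …, μ, μ + δ)`. -/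
noncomputable def slippageMean (k : ℕ) (hk : 2 ≤ k) (μ δ : ℝ) (i : Fin k) : ℝ :=
  if i = bestSystem k hk then μ + δ else μ

/-- The continuous analogue of the vector of cumulative sums: `σ` times a standard Brownian motion
with drift `(μ, …, μ, μ + δ) / σ`. -/
noncomputable def process {Ω : Type*} {k : ℕ} (hk : 2 ≤ k) (μ δ σ : ℝ)
    (B : ℝ≥0 → Ω → Fin k → ℝ) (t : ℝ≥0) (ω : Ω) (i : Fin k) : ℝ :=
  σ * (B t ω i + slippageMean k hk μ δ i / σ * (t : ℝ))

/-- The average of the coordinates of `x` in `I`. -/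
noncomputable def avg {k : ℕ} (I : Finset (Fin k)) (x : Fin k → ℝ) : ℝ :=
  (∑ i ∈ I, x i) / (I.card : ℝ)

/-- The screening statistic `S_I(x) = σ⁻² ∑_{i ∈ I} (x_i - x̄)²`. -/
noncomputable def screeningStat {k : ℕ} (σ : ℝ) (I : Finset (Fin k)) (x : Fin k → ℝ) : ℝ :=
  1 / σ ^ 2 * ∑ i ∈ I, (x i - avg I x) ^ 2

/-- `δ_s = √(δ² (s - 1) / s)`. -/
noncomputable def deltaOf (δ : ℝ) (s : ℕ) : ℝ :=
  Real.sqrt (δ ^ 2 * (((s : ℝ) - 1) / (s : ℝ)))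

/-- The elimination region for the set `I` of competing systems:
`{x : S_I(x) ≥ (σ η_{|I|} / δ_{|I|})²}`. -/
def elimRegion {k : ℕ} (η : ℕ → ℝ) (δ σ : ℝ) (I : Finset (Fin k)) : Set (Fin k → ℝ) :=
  {x | (σ * η I.card / deltaOf δ I.card) ^ 2 ≤ screeningStat σ I x}

/-- `i` is the system in `I` with the smallest value of `x` (ties go to the smallest index).
The cumulative sums and the sample means of the systems in `I` at a given time are in the same
order, so that this can be applied to the cumulative sums. -/
def IsWorst {k : ℕ} (I : Finset (Fin k)) (x : Fin k → ℝ) (i : Fin k) : Prop :=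
  i ∈ I ∧ ∀ j ∈ I, x i < x j ∨ (x i = x j ∧ i ≤ j)

open Classical in
/-- What is left of `I` after the elimination of the system with the smallest value of `x`. -/
noncomputable def survivors {k : ℕ} (I : Finset (Fin k)) (x : Fin k → ℝ) : Finset (Fin k) :=
  I.filter (fun i => ¬ IsWorst I x i)

open Classical in
/-- One elimination along the path `y`. A state `some (I, s)` consists of the set `I` of competing
systems and of the time `s` of the last elimination. If `I` has at least two systems and `y` is in
the elimination region of `I` at some time `t ≥ s`, then the worst system is eliminated at the first
such time (possibly at `s` itself). Otherwise (the procedure has stopped, or samples forever) there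
is no further elimination, and the result is `none`. -/
noncomputable def step {k : ℕ} (η : ℕ → ℝ) (δ σ : ℝ) (y : ℝ≥0 → Fin k → ℝ) :
    Option (Finset (Fin k) × ℝ≥0) → Option (Finset (Fin k) × ℝ≥0)
  | none => none
  | some (I, s) =>
      if 2 ≤ I.card ∧ ∃ t, s ≤ t ∧ y t ∈ elimRegion η δ σ I then
        some (survivors I (y (sInf {t | s ≤ t ∧ y t ∈ elimRegion η δ σ I})),
          sInf {t | s ≤ t ∧ y t ∈ elimRegion η δ σ I})
      else none

/-- The state after `n` eliminations (`none` if there are fewer than `n` eliminations): the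
procedure starts with all the `k` systems at time `0`. -/
noncomputable def stateAfter {k : ℕ} (η : ℕ → ℝ) (δ σ : ℝ) (y : ℝ≥0 → Fin k → ℝ) :
    ℕ → Option (Finset (Fin k) × ℝ≥0)
  | 0 => some (Finset.univ, 0)
  | n + 1 => step η δ σ y (stateAfter η δ σ y n)

/-- System `i` is eliminated at level `ℓ`, that is, it is the `ℓ`-th system to be eliminated
(`ℓ = 1, …, k - 1`). -/
def EliminatedAtLevel {k : ℕ} (η : ℕ → ℝ) (δ σ : ℝ) (y : ℝ≥0 → Fin k → ℝ)
    (ℓ : ℕ) (i : Fin k) : Prop :=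
  ∃ I s J t, stateAfter η δ σ y (ℓ - 1) = some (I, s) ∧ stateAfter η δ σ y ℓ = some (J, t) ∧
    i ∈ I ∧ i ∉ J

/-- The procedure selects system `i`: `i` is the only system left at some point. -/
def Selects {k : ℕ} (η : ℕ → ℝ) (δ σ : ℝ) (y : ℝ≥0 → Fin k → ℝ) (i : Fin k) : Prop :=
  ∃ n t, stateAfter η δ σ y n = some ({i}, t)

/-- Incorrect selection: a system other than the best one is selected. -/
def IncorrectSelection {k : ℕ} (hk : 2 ≤ k) (η : ℕ → ℝ) (δ σ : ℝ)
    (y : ℝ≥0 → Fin k → ℝ) : Prop :=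
  ∃ i, i ≠ bestSystem k hk ∧ Selects η δ σ y i

end DK

namespace DK

/-! ### Scaling: procedures along time-changed, affinely related paths. -/

section Rescaling

variable {k : ℕ}

/-! Brownian scaling with `c = (σ/δ)²` reduces everything to `μ = 0`, `δ = σ = 1`. At time `c * u`
the process is `σ²/δ` times the normalized process at `u`, driven by the Brownian motion `c^(-1/2)
B(c·)`, plus a shift common to all systems (`process_affine`). Elimination regions and rankings
respect this, so path by path both procedures eliminate the same systems in the same order, with
times multiplied by `c` (`competing_process`). It remains to see that two Brownian motions, possibly
on different spaces, give equal probabilities. Their laws agree along a dense sequence of times,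
which determines a continuous path, so it suffices that the events are measurable on path space.
This follows by induction over the eliminations, each time being a hitting time of a closed set
(`measurable_competing_elimTime`, `measure_path_eq`). -/

lemma avg_affine {I : Finset (Fin k)} (hI : I.Nonempty) {x z : Fin k → ℝ} {a b : ℝ}
    (h : ∀ i, x i = a * z i + b) : avg I x = a * avg I z + b := by
  have hc : (I.card : ℝ) ≠ 0 := by exact_mod_cast hI.card_pos.ne'
  simp only [avg, h, Finset.sum_add_distrib, ← Finset.mul_sum, Finset.sum_const, nsmul_eq_mul]
  field_simp

lemma screeningStat_affine (σ : ℝ) (I : Finset (Fin k)) {x z : Fin k → ℝ} {a b : ℝ}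
    (h : ∀ i, x i = a * z i + b) :
    screeningStat σ I x = (a / σ) ^ 2 * screeningStat 1 I z := by
  rcases I.eq_empty_or_nonempty with rfl | hI
  · simp [screeningStat]
  have : ∀ i, (x i - avg I x) ^ 2 = a ^ 2 * (z i - avg I z) ^ 2 := fun i => by
    rw [avg_affine hI h, h i]; ring
  simp only [screeningStat, this, ← Finset.mul_sum]
  ring

lemma deltaOf_eq_mul {δ : ℝ} (hδ : 0 ≤ δ) (s : ℕ) : deltaOf δ s = δ * deltaOf 1 s := by
  rw [deltaOf, deltaOf, Real.sqrt_mul (sq_nonneg δ), Real.sqrt_sq hδ]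
  simp

/-- The slope `σ²/δ` makes the statistic and the squared threshold scale by the same factor
`(σ/δ)²`; the shift cancels in the deviations from the average. -/
lemma mem_elimRegion_affine (η : ℕ → ℝ) {δ σ : ℝ} (hδ : 0 < δ) (hσ : 0 < σ) (I : Finset (Fin k))
    {x z : Fin k → ℝ} {b : ℝ} (h : ∀ i, x i = σ ^ 2 / δ * z i + b) :
    x ∈ elimRegion η δ σ I ↔ z ∈ elimRegion η 1 1 I := by
  have h2 : screeningStat σ I x = (σ / δ) ^ 2 * screeningStat 1 I z := by
    rw [screeningStat_affine σ I h]
    congr 2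
    field_simp
  have h3 : (σ * η I.card / deltaOf δ I.card) ^ 2
      = (σ / δ) ^ 2 * (1 * η I.card / deltaOf 1 I.card) ^ 2 := by
    rw [deltaOf_eq_mul hδ.le, one_mul, ← mul_pow, div_mul_div_comm]
  simp only [elimRegion, Set.mem_ofPred_eq, h2, h3]
  exact mul_le_mul_iff_right₀ (by positivity)

lemma isWorst_affine (I : Finset (Fin k)) {x z : Fin k → ℝ} {a b : ℝ} (ha : 0 < a)
    (h : ∀ i, x i = a * z i + b) (i : Fin k) : IsWorst I x i ↔ IsWorst I z i := by
  simp [IsWorst, h, ha, ha.ne']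

lemma survivors_affine (I : Finset (Fin k)) {x z : Fin k → ℝ} {a b : ℝ} (ha : 0 < a)
    (h : ∀ i, x i = a * z i + b) : survivors I x = survivors I z := by
  ext i
  simp only [survivors, Finset.mem_filter, isWorst_affine I ha h]

lemma sInf_time_change {c : ℝ≥0} (hc : c ≠ 0) {p q : ℝ≥0 → Prop} (h : ∀ u, p (c * u) ↔ q u)
    (hq : ∃ u, q u) : sInf {t | p t} = c * sInf {u | q u} := by
  have hS : {t | p t} = OrderIso.mulLeft₀ c (pos_iff_ne_zero.2 hc) '' {u | q u} := by
    ext t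
    simp only [Set.mem_ofPred_eq, Set.mem_image, OrderIso.mulLeft₀_apply]
    constructor
    · intro ht
      have ht' : c * (c⁻¹ * t) = t := mul_inv_cancel_left₀ hc t
      exact ⟨c⁻¹ * t, (h _).1 (by rwa [ht']), ht'⟩
    · rintro ⟨u, hu, rfl⟩
      exact (h u).2 hu
  rw [hS]
  exact ((OrderIso.mulLeft₀ c (pos_iff_ne_zero.2 hc)).map_csInf hq (OrderBot.bddBelow _)).trans
    sInf_image'.symm |>.symm

/-- `Prod.map id (c * ·)` keeps the competing set and rescales the clock. Multiplication by `c` is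
an order isomorphism of `ℝ≥0`, so first visits correspond. -/
lemma step_time_change (η : ℕ → ℝ) {δ σ δ' σ' : ℝ} {c : ℝ≥0} (hc : c ≠ 0)
    {y z : ℝ≥0 → Fin k → ℝ}
    (hreg : ∀ I u, y (c * u) ∈ elimRegion η δ σ I ↔ z u ∈ elimRegion η δ' σ' I)
    (hsurv : ∀ I u, survivors I (y (c * u)) = survivors I (z u))
    (S : Option (Finset (Fin k) × ℝ≥0)) :
    step η δ σ y (S.map (Prod.map id (c * ·))) =
      (step η δ' σ' z S).map (Prod.map id (c * ·)) := by
  rcases S with _ | ⟨I, s⟩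
  · rfl
  have key : ∀ u, (c * s ≤ c * u ∧ y (c * u) ∈ elimRegion η δ σ I) ↔
      (s ≤ u ∧ z u ∈ elimRegion η δ' σ' I) := fun u => by
    rw [hreg, mul_le_mul_iff_right₀ (pos_iff_ne_zero.2 hc)]
  have hex : (∃ t, c * s ≤ t ∧ y t ∈ elimRegion η δ σ I) ↔
      ∃ u, s ≤ u ∧ z u ∈ elimRegion η δ' σ' I := by
    constructor
    · rintro ⟨t, ht⟩
      refine ⟨c⁻¹ * t, (key _).1 ?_⟩
      rwa [mul_inv_cancel_left₀ hc t]
    · rintro ⟨u, hu⟩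
      exact ⟨c * u, (key u).2 hu⟩
  simp only [Option.map_some, Prod.map_apply, id, step]
  by_cases h : 2 ≤ I.card ∧ ∃ u, s ≤ u ∧ z u ∈ elimRegion η δ' σ' I
  · rw [if_pos h, if_pos ⟨h.1, hex.2 h.2⟩, sInf_time_change
      (p := fun t => c * s ≤ t ∧ y t ∈ elimRegion η δ σ I) hc key h.2, hsurv]
    rfl
  · rw [if_neg h, if_neg fun h' => h ⟨h'.1, hex.1 h'.2⟩]
    rfl

lemma stateAfter_time_change (η : ℕ → ℝ) {δ σ δ' σ' : ℝ} {c : ℝ≥0} (hc : c ≠ 0)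
    {y z : ℝ≥0 → Fin k → ℝ}
    (hreg : ∀ I u, y (c * u) ∈ elimRegion η δ σ I ↔ z u ∈ elimRegion η δ' σ' I)
    (hsurv : ∀ I u, survivors I (y (c * u)) = survivors I (z u)) (n : ℕ) :
    stateAfter η δ σ y n = (stateAfter η δ' σ' z n).map (Prod.map id (c * ·)) := by
  induction n with
  | zero => simp [stateAfter]
  | succ n ih => rw [stateAfter, ih, step_time_change η hc hreg hsurv, stateAfter]

/-- The set of competing systems after `n` eliminations. -/
noncomputable def competing (η : ℕ → ℝ) (δ σ : ℝ) (y : ℝ≥0 → Fin k → ℝ) (n : ℕ) :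
    Option (Finset (Fin k)) :=
  (stateAfter η δ σ y n).map Prod.fst

lemma competing_eq_some {η : ℕ → ℝ} {δ σ : ℝ} {y : ℝ≥0 → Fin k → ℝ} {n : ℕ}
    {I : Finset (Fin k)} :
    competing η δ σ y n = some I ↔ ∃ s, stateAfter η δ σ y n = some (I, s) := by
  simp [competing]

lemma eliminatedAtLevel_iff {η : ℕ → ℝ} {δ σ : ℝ} {y : ℝ≥0 → Fin k → ℝ} {l : ℕ} {i : Fin k} :
    EliminatedAtLevel η δ σ y l i ↔ ∃ I J, competing η δ σ y (l - 1) = some I ∧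
      competing η δ σ y l = some J ∧ i ∈ I ∧ i ∉ J := by
  simp only [EliminatedAtLevel, competing_eq_some]
  grind

lemma selects_iff {η : ℕ → ℝ} {δ σ : ℝ} {y : ℝ≥0 → Fin k → ℝ} {i : Fin k} :
    Selects η δ σ y i ↔ ∃ n, competing η δ σ y n = some {i} := by
  simp only [Selects, competing_eq_some]

/-- Brownian scaling of a vector-valued process. -/
noncomputable def brownianScaling {Ω : Type*} (c : ℝ≥0) (B : ℝ≥0 → Ω → Fin k → ℝ)
    (t : ℝ≥0) (ω : Ω) (i : Fin k) : ℝ :=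
  (√c)⁻¹ * B (c * t) ω i

lemma IsStandardBrownian.brownianScaling {Ω : Type*} [MeasurableSpace Ω] {P : Measure Ω}
    {B : ℝ≥0 → Ω → Fin k → ℝ} (hB : IsStandardBrownian B P) {c : ℝ≥0} (hc : c ≠ 0) :
    IsStandardBrownian (brownianScaling c B) P where
  brownian i := (hB.brownian i).smul hc
  indep := hB.indep.comp (fun _ x t => (√c)⁻¹ * x (c * t)) fun _ => by fun_prop

/-- Here `σ√c = σ²/δ`, and the lead `δ * c * u` of the best system is also `σ²/δ * u`: this `c` is
the one matching noise and drift. -/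
lemma process_affine {Ω : Type*} (hk : 2 ≤ k) (μ : ℝ) {δ σ : ℝ} (hδ : 0 < δ) (hσ : 0 < σ)
    {c : ℝ≥0} (hc : (c : ℝ) = (σ / δ) ^ 2) (B : ℝ≥0 → Ω → Fin k → ℝ) (u : ℝ≥0) (ω : Ω)
    (i : Fin k) :
    process hk μ δ σ B (c * u) ω i =
      σ ^ 2 / δ * process hk 0 1 1 (brownianScaling c B) u ω i + μ * (c * u) := by
  have hs : √(c : ℝ) = σ / δ := by rw [hc, Real.sqrt_sq (by positivity)]
  simp only [process, slippageMean, brownianScaling, hs, NNReal.coe_mul]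
  rw [hc]
  split_ifs <;> field_simp <;> ring

lemma competing_process {Ω : Type*} (hk : 2 ≤ k) (η : ℕ → ℝ) (μ : ℝ) {δ σ : ℝ} (hδ : 0 < δ)
    (hσ : 0 < σ) {c : ℝ≥0} (hc : (c : ℝ) = (σ / δ) ^ 2) (B : ℝ≥0 → Ω → Fin k → ℝ) (ω : Ω)
    (n : ℕ) :
    competing η δ σ (fun t => process hk μ δ σ B t ω) n =
      competing η 1 1 (fun t => process hk 0 1 1 (brownianScaling c B) t ω) n := by
  have hc0 : c ≠ 0 := by
    rintro rfl
    have : (0 : ℝ) < (σ / δ) ^ 2 := by positivity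
    simp [← hc] at this
  have h := process_affine hk μ hδ hσ hc B
  rw [competing, stateAfter_time_change η hc0 (z := fun t => process hk 0 1 1
    (DK.brownianScaling c B) t ω) (fun I u => mem_elimRegion_affine η hδ hσ I (h u ω))
    (fun I u => survivors_affine I (by positivity) (h u ω)), competing, Option.map_map]
  rfl

end Rescaling

/-! ### Measurability of hitting times started at a random time. -/

section Hitting

lemma hitting_attained {E : Type*} [TopologicalSpace E] {y : ℝ≥0 → E} (hy : Continuous y)
    {F : Set E} (hF : IsClosed F) {s : ℝ≥0} (h : ∃ t, s ≤ t ∧ y t ∈ F) :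
    s ≤ sInf {t | s ≤ t ∧ y t ∈ F} ∧ y (sInf {t | s ≤ t ∧ y t ∈ F}) ∈ F :=
  (((isClosed_le continuous_const continuous_id).inter (hF.preimage hy)).csInf_mem h
    (OrderBot.bddBelow _) : _)

/-- A continuous path visits `{0 ≤ f}` during `[s, q]` if and only if it comes arbitrarily close to
it at the times of a dense sequence, projected to `[s, q]`. -/
lemma exists_visit_iff_denseSeq {f : ℝ≥0 → ℝ} (hf : Continuous f) (s q : ℝ≥0) :
    (∃ t, s ≤ t ∧ t ≤ q ∧ 0 ≤ f t) ↔ s ≤ q ∧ ∀ n : ℕ, ∃ m : ℕ,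
      -(1 / ((n : ℝ) + 1)) < f (max s (min (TopologicalSpace.denseSeq ℝ≥0 m) q)) := by
  constructor
  · rintro ⟨t, hst, htq, ht⟩
    refine ⟨hst.trans htq, fun n => ?_⟩
    have hU : IsOpen {r : ℝ≥0 | -(1 / ((n : ℝ) + 1)) < f (max s (min r q))} :=
      isOpen_lt continuous_const (by fun_prop)
    have htU : t ∈ {r : ℝ≥0 | -(1 / ((n : ℝ) + 1)) < f (max s (min r q))} := by
      have : 0 < 1 / ((n : ℝ) + 1) := by positivity
      simp only [Set.mem_ofPred_eq, min_eq_left htq, max_eq_right hst]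
      linarith
    exact (TopologicalSpace.denseRange_denseSeq ℝ≥0).exists_mem_open hU ⟨t, htU⟩
  · rintro ⟨hsq, h⟩
    -- The maximum over `[s, q]` exceeds every `-1/(n+1)`, hence is nonnegative.
    obtain ⟨t, ht, hmax⟩ := isCompact_Icc.exists_isMaxOn (Set.nonempty_Icc.2 hsq) hf.continuousOn
    refine ⟨t, ht.1, ht.2, le_of_forall_pos_lt_add fun ε hε => ?_⟩
    obtain ⟨n, hn⟩ := exists_nat_one_div_lt hε
    obtain ⟨m, hm⟩ := h n
    have := hmax (show max s (min (TopologicalSpace.denseSeq ℝ≥0 m) q) ∈ Set.Icc s q from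
      ⟨le_max_left _ _, max_le hsq (min_le_right _ _)⟩)
    simp only [Set.mem_ofPred_eq] at this
    linarith

variable {C E : Type*} [MeasurableSpace C] [TopologicalSpace E]
  [TopologicalSpace.PseudoMetrizableSpace E] [MeasurableSpace E] [BorelSpace E] {Y : ℝ≥0 → C → E}

lemma measurable_comp_time (hc : ∀ y, Continuous fun t => Y t y) (hm : ∀ t, Measurable (Y t))
    {T : C → ℝ≥0} (hT : Measurable T) : Measurable fun y => Y (T y) y :=
  (measurable_uncurry_of_continuous_of_measurable hc hm).comp (hT.prodMk measurable_id)

variable (hc : ∀ y, Continuous fun t => Y t y) (hm : ∀ t, Measurable (Y t)) {T : C → ℝ≥0}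
  (hT : Measurable T) {f : E → ℝ} (hf : Continuous f)

include hc hm hT hf

lemma measurableSet_visit_le (q : ℝ≥0) :
    MeasurableSet {y | ∃ t, T y ≤ t ∧ t ≤ q ∧ 0 ≤ f (Y t y)} := by
  have : {y | ∃ t, T y ≤ t ∧ t ≤ q ∧ 0 ≤ f (Y t y)} = {y | T y ≤ q ∧ ∀ n : ℕ, ∃ m : ℕ,
      -(1 / ((n : ℝ) + 1)) <
        f (Y (max (T y) (min (TopologicalSpace.denseSeq ℝ≥0 m) q)) y)} := by
    ext y
    exact exists_visit_iff_denseSeq (hf.comp (hc y)) (T y) q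
  rw [this]
  refine (measurableSet_le hT measurable_const).inter ?_
  refine measurableSet_setOfPred.2 (Measurable.forall fun n => Measurable.exists fun m =>
    measurableSet_setOfPred.1 (measurableSet_lt measurable_const (hf.measurable.comp ?_)))
  exact measurable_comp_time hc hm (hT.max measurable_const)

lemma measurableSet_visit : MeasurableSet {y | ∃ t, T y ≤ t ∧ 0 ≤ f (Y t y)} := by
  have : {y | ∃ t, T y ≤ t ∧ 0 ≤ f (Y t y)} =
      ⋃ n : ℕ, {y | ∃ t, T y ≤ t ∧ t ≤ (n : ℝ≥0) ∧ 0 ≤ f (Y t y)} := by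
    ext y
    simp only [Set.mem_ofPred_eq, Set.mem_iUnion]
    constructor
    · rintro ⟨t, h1, h2⟩
      obtain ⟨n, hn⟩ := exists_nat_ge t
      exact ⟨n, t, h1, hn, h2⟩
    · rintro ⟨n, t, h1, -, h2⟩
      exact ⟨t, h1, h2⟩
  rw [this]
  exact MeasurableSet.iUnion fun n => measurableSet_visit_le hc hm hT hf n

lemma measurable_hitting : Measurable fun y => sInf {t | T y ≤ t ∧ 0 ≤ f (Y t y)} := by
  refine measurable_of_Iic fun q => ?_
  have : (fun y => sInf {t | T y ≤ t ∧ 0 ≤ f (Y t y)}) ⁻¹' Set.Iic q =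
      -- Paths that never visit count as `≤ q`, since `sInf ∅ = 0`; otherwise the infimum is
      -- attained.
      {y | ∃ t, T y ≤ t ∧ t ≤ q ∧ 0 ≤ f (Y t y)} ∪ {y | ∃ t, T y ≤ t ∧ 0 ≤ f (Y t y)}ᶜ := by
    ext y
    simp only [Set.mem_preimage, Set.mem_Iic, Set.mem_union, Set.mem_compl_iff, Set.mem_ofPred_eq]
    by_cases h : ∃ t, T y ≤ t ∧ 0 ≤ f (Y t y)
    · have ha : T y ≤ sInf {t | T y ≤ t ∧ 0 ≤ f (Y t y)} ∧
          0 ≤ f (Y (sInf {t | T y ≤ t ∧ 0 ≤ f (Y t y)}) y) :=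
        hitting_attained (hf.comp (hc y)) (isClosed_Ici (a := (0 : ℝ))) h
      simp only [h, not_true_eq_false, or_false]
      constructor
      · exact fun hq => ⟨_, ha.1, hq, ha.2⟩
      · rintro ⟨t, h1, h2, h3⟩
        exact (csInf_le (OrderBot.bddBelow _)
          (show t ∈ {t | T y ≤ t ∧ 0 ≤ f (Y t y)} from ⟨h1, h3⟩)).trans h2
    · have h0 : {t | T y ≤ t ∧ 0 ≤ f (Y t y)} = ∅ :=
        Set.eq_empty_iff_forall_notMem.2 fun t ht => h ⟨t, ht⟩
      simp [h, h0]
  rw [this]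
  exact (measurableSet_visit_le hc hm hT hf q).union (measurableSet_visit hc hm hT hf).compl

end Hitting

/-! ### Measurability of the elimination events. -/

section Measurability

variable {k : ℕ}

lemma continuous_screeningStat (σ : ℝ) (I : Finset (Fin k)) : Continuous (screeningStat σ I) := by
  unfold screeningStat avg
  fun_prop

lemma measurableSet_isWorst (I : Finset (Fin k)) (i : Fin k) :
    MeasurableSet {x : Fin k → ℝ | IsWorst I x i} := by
  unfold IsWorst
  refine (MeasurableSet.const _).inter (measurableSet_setOfPred.2 (Measurable.forall fun j =>
    Measurable.imp measurable_const (Measurable.or ?_ (Measurable.and ?_ measurable_const))))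
  · exact measurableSet_setOfPred.1 (measurableSet_lt (measurable_pi_apply i) (measurable_pi_apply j))
  · exact measurableSet_setOfPred.1
      (measurableSet_eq_fun (measurable_pi_apply i) (measurable_pi_apply j))

lemma measurableSet_survivors_eq (I J : Finset (Fin k)) :
    MeasurableSet {x : Fin k → ℝ | survivors I x = J} := by
  simp only [survivors, Finset.ext_iff, Finset.mem_filter]
  exact measurableSet_setOfPred.2 (Measurable.forall fun i => Measurable.iff (Measurable.and
    measurable_const (measurableSet_setOfPred.1 (measurableSet_isWorst I i)).not) measurable_const)

/-- The time of the `n`-th elimination (`0` if there is none). -/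
noncomputable def elimTime (η : ℕ → ℝ) (δ σ : ℝ) (y : ℝ≥0 → Fin k → ℝ) (n : ℕ) : ℝ≥0 :=
  (stateAfter η δ σ y n).elim 0 Prod.snd

-- Recasts the recursion with a total `ℝ≥0`-valued time, so that it can serve as the random starting
-- time of the next hitting time.
open Classical in
lemma competing_elimTime_succ (η : ℕ → ℝ) (δ σ : ℝ) (y : ℝ≥0 → Fin k → ℝ) (n : ℕ) :
    (competing η δ σ y (n + 1), elimTime η δ σ y (n + 1)) =
      (competing η δ σ y n).elim (none, 0) fun I =>
        if 2 ≤ I.card ∧ ∃ t, elimTime η δ σ y n ≤ t ∧ y t ∈ elimRegion η δ σ I then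
          (some (survivors I (y (sInf {t | elimTime η δ σ y n ≤ t ∧ y t ∈ elimRegion η δ σ I}))),
            sInf {t | elimTime η δ σ y n ≤ t ∧ y t ∈ elimRegion η δ σ I})
        else (none, 0) := by
  have H : ∀ S : Option (Finset (Fin k) × ℝ≥0),
      ((step η δ σ y S).map Prod.fst, (step η δ σ y S).elim 0 Prod.snd) =
        (S.map Prod.fst).elim (none, 0) fun I =>
          if 2 ≤ I.card ∧ ∃ t, S.elim 0 Prod.snd ≤ t ∧ y t ∈ elimRegion η δ σ I then
            (some (survivors I (y (sInf {t | S.elim 0 Prod.snd ≤ t ∧ y t ∈ elimRegion η δ σ I}))),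
              sInf {t | S.elim 0 Prod.snd ≤ t ∧ y t ∈ elimRegion η δ σ I})
          else (none, 0) := by
    rintro (_ | ⟨I, s⟩)
    · rfl
    · by_cases h : 2 ≤ I.card ∧ ∃ t, s ≤ t ∧ y t ∈ elimRegion η δ σ I
      · simp only [step, Option.map_some, Option.elim_some, if_pos h]
        exact (if_pos h).symm
      · simp only [step, Option.map_some, Option.elim_some, if_neg h]
        exact (if_neg h).symm
  exact H (stateAfter η δ σ y n)

lemma measurable_competing_elimTime {C : Type*} [MeasurableSpace C] {Y : ℝ≥0 → C → Fin k → ℝ}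
    (hc : ∀ y, Continuous fun t => Y t y) (hm : ∀ t, Measurable (Y t)) (η : ℕ → ℝ) (δ σ : ℝ)
    (n : ℕ) :
    Measurable[_, (⊤ : MeasurableSpace (Option (Finset (Fin k)))).prod inferInstance]
      fun y => (competing η δ σ (fun t => Y t y) n, elimTime η δ σ (fun t => Y t y) n) := by
  classical
  let _ : MeasurableSpace (Option (Finset (Fin k))) := ⊤
  have : DiscreteMeasurableSpace (Option (Finset (Fin k))) := ⟨fun _ => trivial⟩
  change Measurable fun y => (competing η δ σ (fun t => Y t y) n, elimTime η δ σ (fun t => Y t y) n)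
  induction n with
  | zero => exact measurable_const (a := (some Finset.univ, (0 : ℝ≥0)))
  | succ n ih =>
    simp only [competing_elimTime_succ]
    have hT := ih.snd
    have hJ := ih.fst
    -- The current set becomes a separate variable with countably many values; once it is frozen at
    -- `I`, the region to be hit is fixed.
    suffices H : Measurable fun p : Option (Finset (Fin k)) × C =>
        (p.1.elim (none, 0) fun I =>
        if 2 ≤ I.card ∧ ∃ t, elimTime η δ σ (fun t => Y t p.2) n ≤ t ∧
            Y t p.2 ∈ elimRegion η δ σ I then
          (some (survivors I (Y (sInf {t | elimTime η δ σ (fun t => Y t p.2) n ≤ t ∧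
            Y t p.2 ∈ elimRegion η δ σ I}) p.2)),
            sInf {t | elimTime η δ σ (fun t => Y t p.2) n ≤ t ∧ Y t p.2 ∈ elimRegion η δ σ I})
        else (none, 0) : Option (Finset (Fin k)) × ℝ≥0) from
      H.comp (hJ.prodMk measurable_id)
    refine measurable_from_prod_countable_right fun J => ?_
    rcases J with _ | I
    · exact measurable_const
    have hf : Continuous fun x => screeningStat σ I x - (σ * η I.card / deltaOf δ I.card) ^ 2 :=
      (continuous_screeningStat σ I).sub continuous_const
    have hreg : ∀ x, x ∈ elimRegion η δ σ I ↔
        0 ≤ screeningStat σ I x - (σ * η I.card / deltaOf δ I.card) ^ 2 :=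
      fun x => (sub_nonneg (α := ℝ)).symm
    simp only [Option.elim_some, hreg]
    have hτ := measurable_hitting hc hm hT hf
    refine Measurable.ite ((MeasurableSet.const _).inter (measurableSet_visit hc hm hT hf))
      (Measurable.prodMk ?_ hτ) measurable_const
    have hsurv : Measurable fun x : Fin k → ℝ => some (survivors I x) := by
      refine measurable_to_countable' fun J => ?_
      rcases J with _ | J
      · convert MeasurableSet.empty
        exact Set.eq_empty_iff_forall_notMem.2 fun _ h => Option.some_ne_none _ h
      · convert measurableSet_survivors_eq I J
        ext x
        exact Option.some_inj
    exact hsurv.comp (measurable_comp_time hc hm hτ)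

variable {C : Type*} [MeasurableSpace C] {Y : ℝ≥0 → C → Fin k → ℝ}
    (hc : ∀ y, Continuous fun t => Y t y) (hm : ∀ t, Measurable (Y t)) (η : ℕ → ℝ) (δ σ : ℝ)

include hc hm

lemma measurableSet_competing_eq (n : ℕ) (J : Option (Finset (Fin k))) :
    MeasurableSet {y | competing η δ σ (fun t => Y t y) n = J} := by
  let _ : MeasurableSpace (Option (Finset (Fin k))) := ⊤
  exact (measurable_competing_elimTime hc hm η δ σ n).fst (show MeasurableSet {J} from trivial)

lemma measurableSet_eliminatedAtLevel (l : ℕ) (i : Fin k) :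
    MeasurableSet {y | EliminatedAtLevel η δ σ (fun t => Y t y) l i} := by
  simp only [eliminatedAtLevel_iff]
  have h := fun n J => measurableSet_setOfPred.1 (measurableSet_competing_eq hc hm η δ σ n J)
  exact measurableSet_setOfPred.2 (Measurable.exists fun I => Measurable.exists fun J =>
    (h _ _).and ((h _ _).and (measurable_const.and measurable_const)))

lemma measurableSet_incorrectSelection (hk : 2 ≤ k) :
    MeasurableSet {y | IncorrectSelection hk η δ σ (fun t => Y t y)} := by
  simp only [IncorrectSelection, selects_iff]
  have h := fun n J => measurableSet_setOfPred.1 (measurableSet_competing_eq hc hm η δ σ n J)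
  exact measurableSet_setOfPred.2 (Measurable.exists fun i => measurable_const.and
    (Measurable.exists fun n => h _ _))

end Measurability

/-! ### Uniqueness of the law, and transfer between probability spaces. -/

section Law

variable {Ω Ω' : Type*} [MeasurableSpace Ω] [MeasurableSpace Ω'] {P : Measure Ω} {P' : Measure Ω'}
  {k : ℕ}

/-- Since `d` need not be injective, the marginals come from those on the finite set of times
`I.image d` by reindexing. -/
lemma map_restrict_comp_eq {ι : Type*} {X : ℝ≥0 → Ω → ℝ} {X' : ℝ≥0 → Ω' → ℝ}
    (hX : IsPreBrownianReal X P) (hX' : IsPreBrownianReal X' P') (d : ι → ℝ≥0) (I : Finset ι) :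
    P.map (fun ω => I.restrict fun i => X (d i) ω) =
      P'.map (fun ω => I.restrict fun i => X' (d i) ω) := by
  classical
  let g : (↥(I.image d) → ℝ) → I → ℝ :=
    fun x i => x ⟨d i, Finset.mem_image_of_mem d i.2⟩
  have hg : Measurable g := by fun_prop
  have h := hX.hasLaw (I.image d)
  have h' := hX'.hasLaw (I.image d)
  have e := AEMeasurable.map_map_of_aemeasurable hg.aemeasurable h.aemeasurable
  have e' := AEMeasurable.map_map_of_aemeasurable hg.aemeasurable h'.aemeasurable
  rw [h.map_eq] at e
  rw [h'.map_eq] at e'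
  exact e.symm.trans e'

lemma identDistrib_comp_of_isPreBrownianReal [IsFiniteMeasure P'] {ι : Type*} [Countable ι]
    {X : ℝ≥0 → Ω → ℝ} {X' : ℝ≥0 → Ω' → ℝ} (hX : IsPreBrownianReal X P)
    (hX' : IsPreBrownianReal X' P') (d : ι → ℝ≥0) :
    IdentDistrib (fun ω i => X (d i) ω) (fun ω i => X' (d i) ω) P P' := by
  have h : AEMeasurable (fun ω i => X (d i) ω) P :=
    aemeasurable_pi_lambda _ fun i => hX.aemeasurable _
  have h' : AEMeasurable (fun ω i => X' (d i) ω) P' :=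
    aemeasurable_pi_lambda _ fun i => hX'.aemeasurable _
  refine ⟨h, h', ?_⟩
  have hl := isProjectiveLimit_map (X := fun i => X (d i)) h
  have hl' := isProjectiveLimit_map (X := fun i => X' (d i)) h'
  simp_rw [map_restrict_comp_eq hX hX' d] at hl
  exact hl.unique hl'

lemma IsStandardBrownian.identDistrib_comp [IsFiniteMeasure P'] {ι : Type*} [Countable ι]
    {B : ℝ≥0 → Ω → Fin k → ℝ} {B' : ℝ≥0 → Ω' → Fin k → ℝ} (hB : IsStandardBrownian B P)
    (hB' : IsStandardBrownian B' P') (d : ι → ℝ≥0) :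
    IdentDistrib (fun ω j => B (d j) ω) (fun ω j => B' (d j) ω) P P' := by
  have hd : Measurable fun (x : ℝ≥0 → ℝ) (j : ι) => x (d j) := by fun_prop
  have h := IdentDistrib.pi (X := fun i ω j => B (d j) ω i) (Y := fun i ω j => B' (d j) ω i)
    (fun i => identDistrib_comp_of_isPreBrownianReal (hB.brownian i).toIsPreBrownianReal
      (hB'.brownian i).toIsPreBrownianReal d)
    (hB.indep.comp (fun _ x j => x (d j)) fun _ => hd)
    (hB'.indep.comp (fun _ x j => x (d j)) fun _ => hd)
  exact h.comp (u := fun (x : Fin k → ι → ℝ) j i => x i j) (by fun_prop)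

lemma IsStandardBrownian.ae_continuous {B : ℝ≥0 → Ω → Fin k → ℝ} (hB : IsStandardBrownian B P) :
    ∀ᵐ ω ∂P, Continuous fun t => B t ω := by
  filter_upwards [ae_all_iff.2 fun i => (hB.brownian i).cont] with ω h
  exact continuous_pi h

/-- Continuous paths, with the `σ`-algebra generated by the values along a dense sequence. -/
def Path (k : ℕ) : Type := {y : ℝ≥0 → Fin k → ℝ // Continuous y}

/-- The values of a path along a dense sequence of times. -/
noncomputable def Path.sample {k : ℕ} (y : Path k) (n : ℕ) : Fin k → ℝ :=
  y.1 (TopologicalSpace.denseSeq ℝ≥0 n)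

noncomputable instance : MeasurableSpace (Path k) := MeasurableSpace.comap Path.sample inferInstance

/-- By continuity, evaluation at `t` is a limit of evaluations at times of the dense sequence. -/
lemma Path.measurable_eval (t : ℝ≥0) : Measurable fun y : Path k => y.1 t := by
  obtain ⟨u, hu, hut⟩ := mem_closure_iff_seq_limit.1
    (TopologicalSpace.denseRange_denseSeq ℝ≥0 t)
  choose m hm using hu
  have hs : Measurable (Path.sample : Path k → ℕ → Fin k → ℝ) := comap_measurable _
  refine measurable_of_tendsto_metrizable (f := fun n (y : Path k) => y.1 (u n)) (fun n => ?_)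
    (tendsto_pi_nhds.2 fun y => (y.2.tendsto t).comp hut)
  rw [← hm n]
  exact (measurable_pi_apply (m n)).comp hs

/-- Two processes with almost surely continuous paths which have the same law along a dense
sequence of times give the same probability to every measurable set of continuous paths. -/
lemma measure_path_eq {Z : Ω → ℝ≥0 → Fin k → ℝ} {Z' : Ω' → ℝ≥0 → Fin k → ℝ}
    (hZ : ∀ᵐ ω ∂P, Continuous (Z ω)) (hZ' : ∀ᵐ ω ∂P', Continuous (Z' ω))
    (h : IdentDistrib (fun ω n => Z ω (TopologicalSpace.denseSeq ℝ≥0 n))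
      (fun ω n => Z' ω (TopologicalSpace.denseSeq ℝ≥0 n)) P P')
    {E : Set (ℝ≥0 → Fin k → ℝ)} (hE : MeasurableSet {y : Path k | y.1 ∈ E}) :
    P {ω | Z ω ∈ E} = P' {ω | Z' ω ∈ E} := by
  obtain ⟨A, hA, hAE⟩ := hE
  have key : ∀ y : ℝ≥0 → Fin k → ℝ, Continuous y →
      (y ∈ E ↔ (fun n => y (TopologicalSpace.denseSeq ℝ≥0 n)) ∈ A) := fun y hy =>
    (Set.ext_iff.1 hAE ⟨y, hy⟩).symm
  calc P {ω | Z ω ∈ E} = P ((fun ω n => Z ω (TopologicalSpace.denseSeq ℝ≥0 n)) ⁻¹' A) := by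
        refine measure_congr ?_
        filter_upwards [hZ] with ω hω
        exact propext (key _ hω)
    _ = P' ((fun ω n => Z' ω (TopologicalSpace.denseSeq ℝ≥0 n)) ⁻¹' A) := h.measure_mem_eq hA
    _ = P' {ω | Z' ω ∈ E} := by
        refine measure_congr ?_
        filter_upwards [hZ'] with ω hω
        exact propext (key _ hω).symm

lemma measure_process_mem_eq [IsFiniteMeasure P'] {B : ℝ≥0 → Ω → Fin k → ℝ}
    {B' : ℝ≥0 → Ω' → Fin k → ℝ} (hB : IsStandardBrownian B P) (hB' : IsStandardBrownian B' P')
    (hk : 2 ≤ k) (μ δ σ : ℝ) {E : Set (ℝ≥0 → Fin k → ℝ)}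
    (hE : MeasurableSet {y : Path k | y.1 ∈ E}) :
    P {ω | (fun t => process hk μ δ σ B t ω) ∈ E} =
      P' {ω | (fun t => process hk μ δ σ B' t ω) ∈ E} := by
  refine measure_path_eq (Z := fun ω t => process hk μ δ σ B t ω)
    (Z' := fun ω t => process hk μ δ σ B' t ω) ?_ ?_ ?_ hE
  · filter_upwards [hB.ae_continuous] with ω h
    unfold process
    fun_prop
  · filter_upwards [hB'.ae_continuous] with ω h
    unfold process
    fun_prop
  · exact (hB.identDistrib_comp hB' (TopologicalSpace.denseSeq ℝ≥0)).comp
      (u := fun x n i => σ * (x n i + slippageMean k hk μ δ i / σ *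
        (TopologicalSpace.denseSeq ℝ≥0 n : ℝ))) (by fun_prop)

/-- The probability of an event determined by the sequence of sets of competing systems does not
depend on the parameters. -/
lemma measure_eq_of_competing [IsFiniteMeasure P'] {B : ℝ≥0 → Ω → Fin k → ℝ}
    {B' : ℝ≥0 → Ω' → Fin k → ℝ} (hB : IsStandardBrownian B P) (hB' : IsStandardBrownian B' P')
    (hk : 2 ≤ k) (η : ℕ → ℝ) (μ μ' : ℝ) {δ σ δ' σ' : ℝ} (hδ : 0 < δ) (hσ : 0 < σ) (hδ' : 0 < δ')
    (hσ' : 0 < σ') {G : (ℕ → Option (Finset (Fin k))) → Prop}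
    (hG : MeasurableSet {y : Path k | G (competing η 1 1 y.1)}) :
    P {ω | G (competing η δ σ (fun t => process hk μ δ σ B t ω))} =
      P' {ω | G (competing η δ' σ' (fun t => process hk μ' δ' σ' B' t ω))} := by
  have scale : ∀ {δ σ : ℝ}, 0 < δ → 0 < σ → ∃ c : ℝ≥0, c ≠ 0 ∧ (c : ℝ) = (σ / δ) ^ 2 :=
    fun {δ σ} hδ hσ => by
      have : 0 < (σ / δ) ^ 2 := by positivity
      refine ⟨⟨_, this.le⟩, fun h => this.ne' (congrArg NNReal.toReal h), rfl⟩
  obtain ⟨c, hc0, hc⟩ := scale hδ hσ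
  obtain ⟨c', hc0', hc'⟩ := scale hδ' hσ'
  simp only [fun ω => funext (competing_process hk η μ hδ hσ hc B ω),
    fun ω => funext (competing_process hk η μ' hδ' hσ' hc' B' ω)]
  exact measure_process_mem_eq (hB.brownianScaling hc0) (hB'.brownianScaling hc0') hk 0 1 1
    (E := {y | G (competing η 1 1 y)}) hG

end Law

end DK

theorem lemma3 {Ω Ω' : Type*} [MeasurableSpace Ω] [MeasurableSpace Ω']
    (P : Measure Ω) [IsProbabilityMeasure P] (P' : Measure Ω') [IsProbabilityMeasure P']
    (k : ℕ) (hk : 2 ≤ k) (η : ℕ → ℝ)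
    (B : ℝ≥0 → Ω → Fin k → ℝ) (hB : DK.IsStandardBrownian B P)
    (B' : ℝ≥0 → Ω' → Fin k → ℝ) (hB' : DK.IsStandardBrownian B' P')
    (μ δ σ : ℝ) (hδ : 0 < δ) (hσ : 0 < σ)
    (μ' δ' σ' : ℝ) (hδ' : 0 < δ') (hσ' : 0 < σ') :
    (∀ (ℓ : ℕ) (i : Fin k),
      P {ω | DK.EliminatedAtLevel η δ σ (fun t => DK.process hk μ δ σ B t ω) ℓ i} =
        P' {ω | DK.EliminatedAtLevel η δ' σ' (fun t => DK.process hk μ' δ' σ' B' t ω) ℓ i}) ∧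
    (∀ ℓ : ℕ,
      P {ω | ∃ i, DK.EliminatedAtLevel η δ σ (fun t => DK.process hk μ δ σ B t ω) ℓ i} =
        P' {ω | ∃ i, DK.EliminatedAtLevel η δ' σ' (fun t => DK.process hk μ' δ' σ' B' t ω) ℓ i}) ∧
    P {ω | DK.IncorrectSelection hk η δ σ (fun t => DK.process hk μ δ σ B t ω)} =
      P' {ω | DK.IncorrectSelection hk η δ' σ' (fun t => DK.process hk μ' δ' σ' B' t ω)} := by
  have hc : ∀ y : DK.Path k, Continuous fun t => y.1 t := fun y => y.2
  have hel := DK.measurableSet_eliminatedAtLevel hc DK.Path.measurable_eval η 1 1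
  have hsel := DK.measurableSet_incorrectSelection hc DK.Path.measurable_eval η 1 1 hk
  refine ⟨fun l i => ?_, fun l => ?_, ?_⟩
  · have h := hel l i
    simp only [DK.eliminatedAtLevel_iff] at h ⊢
    exact DK.measure_eq_of_competing hB hB' hk η μ μ' hδ hσ hδ' hσ' (G := fun J => ∃ I I',
      J (l - 1) = some I ∧ J l = some I' ∧ i ∈ I ∧ i ∉ I') h
  · have h : MeasurableSet {y : DK.Path k | ∃ i, DK.EliminatedAtLevel η 1 1 y.1 l i} :=
      measurableSet_setOfPred.2 (Measurable.exists fun i => measurableSet_setOfPred.1 (hel l i))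
    simp only [DK.eliminatedAtLevel_iff] at h ⊢
    exact DK.measure_eq_of_competing hB hB' hk η μ μ' hδ hσ hδ' hσ' (G := fun J => ∃ i, ∃ I I',
      J (l - 1) = some I ∧ J l = some I' ∧ i ∈ I ∧ i ∉ I') h
  · simp only [DK.IncorrectSelection, DK.selects_iff] at hsel ⊢
    exact DK.measure_eq_of_competing hB hB' hk η μ μ' hδ hσ hδ' hσ' (G := fun J =>
      ∃ i, i ≠ DK.bestSystem k hk ∧ ∃ n, J n = some {i}) hsel
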